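/- Let $(R,\mathfrak m)$ be a Noetherian local ring, $I$ an ideal of $R$ and $k\ge -1$ an integer; dimensions of modules are Krull dimensions of their supports, with $\dim 0=-\infty$. For a finitely generated $R$-module $N$, a sequence $x_1,\dots,x_r\in\mathfrak m$ is called an $N$-sequence in dimension $>k$ if $x_i\notin\mathfrak p$ for all $i=1,\dots,r$ and all $\mathfrak p\in\operatorname{Ass}_R(N/(x_1,\dots,x_{i-1})N)$ with $\dim(R/\mathfrak p)>k$. If $\dim(N/IN)>k$, then $\operatorname{depth}_k(I,N)$ denotes the common length of all maximal $N$-sequences in dimension $>k$ in $I$; if $\dim(N/IN)\le k$, then $\operatorname{depth}_k(I,N)=\infty$. Let $(N_n)_{n\ge 0}$ be one of the following two families of $R$-modules: (a) $N_n=M_n$, where $\mathcal M=\bigoplus_{n\ge 0}M_n$ is a finitely generated graded module over a finitely generated standard graded algebra $\mathcal R=\bigoplus_{n\ge 0}R_n$ over $R_0=R$ (standard means generated over $R$ by $R_1$); (b) $N_n=M/J^nM$, where $J$ is an ideal of $R$ and $M$ is a finitely generated $R$-module. Then $\operatorname{depth}_k(I,N_n)$ takes a constant value $r\in\{0,1,2,\dots\}\cup\{\infty\}$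 for all large $n$, and this eventual value is $$r=\inf\{\,i\ge 0\mid \dim(\operatorname{Ext}^i_R(R/I,N_n))>k\ \text{ for infinitely many } n\,\},$$ where $\inf\emptyset=\infty$. -/

import Mathlib

open CategoryTheory Filter

universe u

/-- `dim > k`, for an integer `k ≥ -1` and a Krull dimension `d` with values in
`{-∞} ∪ ℕ ∪ {∞}`. In particular `dim 0 = ⊥` is not `> -1`. -/
def DimGT (k : ℤ) (d : WithBot ℕ∞) : Prop :=
  ∃ j : ℕ, k < (j : ℤ) ∧ (j : WithBot ℕ∞) ≤ d

section Sequences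

variable {R : Type u} [CommRing R] [IsLocalRing R]

/-- The list `xs = [x₁, …, x_r]` is an `M`-sequence in dimension `> k`: all `x_i` lie in the
maximal ideal, and `x_i ∉ 𝔭` for every `𝔭 ∈ Ass (M / (x₁, …, x_{i-1}) M)` with
`dim (R / 𝔭) > k`. -/
def IsSeqInDimGT (k : ℤ) (M : Type u) [AddCommGroup M] [Module R M] (xs : List R) : Prop :=
  (∀ x ∈ xs, x ∈ IsLocalRing.maximalIdeal R) ∧
  ∀ (i : ℕ) (hi : i < xs.length),
    ∀ p ∈ associatedPrimes R (M ⧸ (Ideal.ofList (xs.take i) • (⊤ : Submodule R M))),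
      DimGT k (ringKrullDim (R ⧸ p)) → xs[i] ∉ p

/-- `xs` is a maximal `M`-sequence in dimension `> k` in the ideal `I`: it consists of elements
of `I` and cannot be prolonged by an element of `I`. -/
def IsMaxSeqInDimGT (k : ℤ) (I : Ideal R) (M : Type u) [AddCommGroup M] [Module R M]
    (xs : List R) : Prop :=
  (∀ x ∈ xs, x ∈ I) ∧ IsSeqInDimGT k M xs ∧ ∀ x ∈ I, ¬ IsSeqInDimGT k M (xs ++ [x])

/-- `depth_k(I, M) = r`. If `dim (M / I M) > k`, this says that maximal `M`-sequences in
dimension `> k` in `I` exist and that all of them have length `r`; if `dim (M / I M) ≤ k`, then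
`depth_k(I, M) = ∞` by convention. -/
def IsDepthInDimGT (k : ℤ) (I : Ideal R) (M : Type u) [AddCommGroup M] [Module R M]
    (r : ℕ∞) : Prop :=
  (DimGT k (Module.supportDim R (M ⧸ (I • (⊤ : Submodule R M)))) ∧
    (∃ xs : List R, IsMaxSeqInDimGT k I M xs) ∧
    ∀ xs : List R, IsMaxSeqInDimGT k I M xs → (xs.length : ℕ∞) = r) ∨
  (¬ DimGT k (Module.supportDim R (M ⧸ (I • (⊤ : Submodule R M)))) ∧ r = ⊤)

theorem IsDepthInDimGT.unique {k : ℤ} {I : Ideal R} {M : Type u} [AddCommGroup M] [Module R M]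
    {r s : ℕ∞} (hr : IsDepthInDimGT k I M r) (hs : IsDepthInDimGT k I M s) : r = s := by
  rcases hr with ⟨h1, ⟨xs, hxs⟩, h2⟩ | ⟨h1, h2⟩ <;>
    rcases hs with ⟨h3, _, h4⟩ | ⟨h3, h4⟩
  · rw [← h2 xs hxs, ← h4 xs hxs]
  · exact absurd h1 h3
  · exact absurd h3 h1
  · rw [h2, h4]

end Sequences

/-- The Krull dimension (of the support) of the `R`-module `Ext^i_R(R / I, M)`. -/
noncomputable def extDim {R : Type u} [CommRing R] (I : Ideal R) (M : Type u) [AddCommGroup M]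
    [Module R M] (i : ℕ) : WithBot ℕ∞ :=
  Module.supportDim R (Abelian.Ext.{u} (ModuleCat.of R (R ⧸ I)) (ModuleCat.of R M) i)

/-- `S = ⨁ 𝒜 n` is a finitely generated standard graded algebra over `𝒜 0 = R`: it is a finitely
generated `R`-algebra, generated by its elements of degree one. -/
structure IsStandardGraded {R S : Type u} [CommRing R] [CommRing S] [Algebra R S]
    (𝒜 : ℕ → Submodule R S) [GradedAlgebra 𝒜] : Prop where
  injective : Function.Injective (algebraMap R S)
  zero_eq : ∀ s : S, s ∈ 𝒜 0 ↔ s ∈ Set.range (algebraMap R S)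
  generated : Algebra.adjoin R (𝒜 1 : Set S) = ⊤
  finiteType : Algebra.FiniteType R S

/-!
The value of `depth_k(I, N)` is the first index `i` with `dim Ext^i(R/I, N) > k`, and the whole
statement reduces to the stability of associated primes.

*A single module.* A module has dimension `> k` exactly if its support contains a prime `𝔭` with
`dim R/𝔭 > k`. At such a prime a sequence in dimension `> k` is weakly regular on `N_𝔭`. For `x ∈ I`
with `(0 :_N x)_𝔭 = 0`, the sequences `0 → (0 :_N x) → N → xN → 0` and `0 → xN → N → N/xN → 0`, and
the fact that `x` kills `Ext(R/I, -)`, show that passing from `N` to `N/xN` lowers the first index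
with `Ext^i(R/I, -)_𝔭 ≠ 0` by one (`support_ext_of_list`). No localization of Ext is needed: being
zero at `𝔭` means that each element is killed by some `s ∉ 𝔭`. If a sequence in `I` is maximal,
prime avoidance puts `I` inside an associated prime `𝔮` of `N/(xs)N` with `dim R/𝔮 > k`, whence
`Hom(R/I, N/(xs)N)_𝔮 ≠ 0`. So all maximal sequences have the expected length
(`IsMaxSeqInDimGT.isDepthInDimGT`).

*A family.* Suppose that for each ideal `𝔞` the set `Ass (N_n / 𝔞 N_n)` is constant for large `n`
(`HasStableAssociatedPrimes`). Whether a sequence is an `N_n`-sequence in dimension `> k`, whether it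
is maximal in `I`, and whether `dim (N_n / I N_n) > k`, depends on these sets only. Hence one
sequence is maximal for all large `n`, and its length is the eventual depth
(`HasStableAssociatedPrimes.exists_eventually_isDepthInDimGT`).

*Stability.* Let `N_n` be the components of a finitely generated graded module `E` over a standard
graded Noetherian algebra `S`. The elements of `E` killed by `S_1` form a finitely generated
`R`-module, so they live in bounded degrees; thus `N_n` embeds into a power of `N_{n+1}` for large
`n`, and `Ass N_n` increases inside the finite set of contractions of `Ass_S E`
(`exists_eventually_associatedPrimes_eq`). Applied to `E/𝔞E` this settles graded modules. Applied to
the associated graded module of `M` with respect to `J` it gives Brodmann's theorem that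
`Ass (M/JⁿM)` is eventually constant, and `(M/JⁿM)/𝔞(M/JⁿM) = (M/𝔞M)/Jⁿ(M/𝔞M)` reduces the second
family to it.
-/

/-! ### Dimension and support -/

section Support

variable {R : Type u} [CommRing R]

/-- Supports are closed under specialization, so their dimension is attained on sets `V(𝔭)`. -/
lemma dimGT_supportDim_iff {k : ℤ} {L : Type*} [AddCommGroup L] [Module R L] :
    DimGT k (Module.supportDim R L) ↔
      ∃ p ∈ Module.support R L, DimGT k (ringKrullDim (R ⧸ p.asIdeal)) := by
  constructor
  · rintro ⟨j, hkj, hj⟩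
    obtain ⟨l, hl⟩ := Order.le_krullDim_iff.mp hj
    refine ⟨l.head.1, l.head.2, j, hkj, ?_⟩
    rw [ringKrullDim_quotient]
    refine Order.le_krullDim_iff.mpr
      ⟨⟨l.length, fun i => ⟨(l i).1, ?_⟩, fun i => ?_⟩, hl⟩
    · have h : l.head ≤ l i := LTSeries.head_le l i
      exact h
    · exact l.step i
  · rintro ⟨p, hp, j, hkj, hj⟩
    refine ⟨j, hkj, hj.trans ?_⟩
    rw [ringKrullDim_quotient]
    exact Order.krullDim_le_of_strictMono
      (fun a : PrimeSpectrum.zeroLocus (p.asIdeal : Set R) =>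
        (⟨a.1, Module.mem_support_mono (show p ≤ a.1 from a.2) hp⟩ : Module.support R L))
      (fun _ _ h => h)

lemma DimGT.quotient_anti {k : ℤ} {p q : Ideal R} (hqp : q ≤ p)
    (h : DimGT k (ringKrullDim (R ⧸ p))) : DimGT k (ringKrullDim (R ⧸ q)) := by
  obtain ⟨j, hkj, hj⟩ := h
  exact ⟨j, hkj, hj.trans (ringKrullDim_le_of_surjective (Ideal.Quotient.factor hqp)
    (Ideal.Quotient.factor_surjective hqp))⟩

variable [IsNoetherianRing R] {L : Type*} [AddCommGroup L] [Module R L]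

lemma exists_associatedPrimes_le_of_mem_support {p : PrimeSpectrum R}
    (hp : p ∈ Module.support R L) : ∃ q ∈ associatedPrimes R L, q ≤ p.asIdeal := by
  obtain ⟨m, hm⟩ := Module.mem_support_iff_exists_annihilator.mp hp
  obtain ⟨q, hq, hqp⟩ := Ideal.exists_minimalPrimes_le hm
  exact ⟨q, associatedPrimes.subset_of_injective (f := (R ∙ m).subtype)
    Subtype.val_injective
    (Module.associatedPrimes.minimalPrimes_annihilator_subset_associatedPrimes R _ hq), hqp⟩

lemma mem_associatedPrimes_iff_exists {p : Ideal R} :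
    p ∈ associatedPrimes R L ↔ p.IsPrime ∧ ∃ m : L, ∀ r, r ∈ p ↔ r • m = 0 := by
  rw [AssociatedPrimes.mem_iff, isAssociatedPrime_iff]
  simp [SetLike.ext_iff, Submodule.mem_colon_singleton]

lemma mem_support_of_mem_associatedPrimes {p : PrimeSpectrum R}
    (hp : p.asIdeal ∈ associatedPrimes R L) : p ∈ Module.support R L := by
  obtain ⟨-, m, hm⟩ := mem_associatedPrimes_iff_exists.mp hp
  exact Module.mem_support_iff'.mpr ⟨m, fun r hr h => hr ((hm r).mpr h)⟩

lemma dimGT_supportDim_iff_associatedPrimes {k : ℤ} :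
    DimGT k (Module.supportDim R L) ↔
      ∃ p ∈ associatedPrimes R L, DimGT k (ringKrullDim (R ⧸ p)) := by
  rw [dimGT_supportDim_iff]
  constructor
  · rintro ⟨p, hp, hk⟩
    obtain ⟨q, hq, hqp⟩ := exists_associatedPrimes_le_of_mem_support hp
    exact ⟨q, hq, hk.quotient_anti hqp⟩
  · rintro ⟨p, hp, hk⟩
    exact ⟨⟨p, hp.1⟩, mem_support_of_mem_associatedPrimes hp, hk⟩

omit [IsNoetherianRing R] in
lemma notMem_support_of_exact {A B C : Type*} [AddCommGroup A] [Module R A] [AddCommGroup B]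
    [Module R B] [AddCommGroup C] [Module R C] {f : A →ₗ[R] B} {g : B →ₗ[R] C}
    (h : Function.Exact f g) {p : PrimeSpectrum R} (hA : p ∉ Module.support R A)
    (hC : p ∉ Module.support R C) : p ∉ Module.support R B := by
  rw [Module.notMem_support_iff'] at *
  intro b
  obtain ⟨s, hs, hsb⟩ := hC (g b)
  obtain ⟨a, ha⟩ := (h (s • b)).mp (by rw [map_smul, hsb])
  obtain ⟨t, ht, hta⟩ := hA a
  refine ⟨t * s, fun hts => (p.2.mem_or_mem hts).elim ht hs, ?_⟩
  rw [mul_smul, ← ha, ← map_smul, hta, map_zero]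

/-- An element outside all associated primes contained in `𝔭` is a nonzerodivisor on `L_𝔭`. -/
lemma notMem_support_ker_lsmul {p : PrimeSpectrum R} {x : R}
    (hx : ∀ q ∈ associatedPrimes R L, q ≤ p.asIdeal → x ∉ q) :
    p ∉ Module.support R (LinearMap.ker (LinearMap.lsmul R L x)) := by
  intro hp
  obtain ⟨q, hq, hqp⟩ := exists_associatedPrimes_le_of_mem_support hp
  refine hx q (associatedPrimes.subset_of_injective (f := Submodule.subtype _)
    Subtype.val_injective hq) hqp ?_
  obtain ⟨-, m, hm⟩ := mem_associatedPrimes_iff_exists.mp hq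
  exact (hm x).mpr (Subtype.ext m.2)

end Support

/-! ### Supports of Ext modules -/

section Ext

open Abelian

variable {R : Type u} [CommRing R]

lemma smul_ext_eq_zero_right {X : ModuleCat.{u} R} {K : Type u} [AddCommGroup K] [Module R K]
    {s : R} (hs : ∀ y : K, s • y = 0) {i : ℕ} (e : Ext.{u} X (ModuleCat.of R K) i) :
    s • e = 0 := by
  have h : s • 𝟙 (ModuleCat.of R K) = 0 := by
    ext y; exact hs y
  rw [Ext.smul_eq_comp_mk₀, h, Ext.mk₀_zero, Ext.comp_zero]

lemma smul_ext_eq_zero_left {K : Type u} [AddCommGroup K] [Module R K] {Y : ModuleCat.{u} R}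
    {s : R} (hs : ∀ y : K, s • y = 0) {i : ℕ} (e : Ext.{u} (ModuleCat.of R K) Y i) :
    s • e = 0 := by
  have h : s • 𝟙 (ModuleCat.of R K) = 0 := by
    ext y; exact hs y
  rw [← Ext.mk₀_id_comp e, ← Ext.smul_comp, ← Ext.mk₀_smul, h, Ext.mk₀_zero, Ext.zero_comp]

/-- A finitely generated module that vanishes at `𝔭` is killed by a single `s ∉ 𝔭`, which then kills
its Ext modules. -/
lemma notMem_support_ext_right {X : ModuleCat.{u} R} {K : Type u} [AddCommGroup K] [Module R K]
    [Module.Finite R K] {p : PrimeSpectrum R} (hp : p ∉ Module.support R K) (i : ℕ) :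
    p ∉ Module.support R (Ext.{u} X (ModuleCat.of R K) i) := by
  rw [Module.mem_support_iff_of_finite, SetLike.not_le_iff_exists] at hp
  obtain ⟨s, hs, hsp⟩ := hp
  exact Module.notMem_support_iff'.mpr fun e =>
    ⟨s, hsp, smul_ext_eq_zero_right (Module.mem_annihilator.mp hs) e⟩

variable (I : Ideal R)

lemma smul_ext_quotient_eq_zero {Y : ModuleCat.{u} R} {i : ℕ} {x : R} (hx : x ∈ I)
    (e : Ext.{u} (ModuleCat.of R (R ⧸ I)) Y i) : x • e = 0 := by
  refine smul_ext_eq_zero_left (fun y => ?_) e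
  obtain ⟨r, rfl⟩ := Ideal.Quotient.mk_surjective y
  rw [← Ideal.Quotient.mk_eq_mk, ← Submodule.Quotient.mk_smul, Submodule.Quotient.mk_eq_zero]
  exact I.mul_mem_right r hx

lemma support_ext_subset (N : Type u) [AddCommGroup N] [Module R N] [Module.Finite R N] (i : ℕ) :
    Module.support R (Ext.{u} (ModuleCat.of R (R ⧸ I)) (ModuleCat.of R N) i) ⊆
      Module.support R (N ⧸ (I • (⊤ : Submodule R N))) := by
  intro p hp
  rw [Module.support_quotient]
  refine ⟨not_not.mp fun h => notMem_support_ext_right h i hp, fun x hx => ?_⟩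
  by_contra hxp
  exact Module.notMem_support_iff'.mpr
    (fun e => ⟨x, hxp, smul_ext_quotient_eq_zero I hx e⟩) hp

end Ext

/-! ### Ext modules modulo a filter-regular element -/

section ExtStep

open Abelian

variable {R : Type u} [CommRing R]

lemma support_ext_zero {X Y : ModuleCat.{u} R} :
    Module.support R (Ext.{u} X Y 0) = Module.support R (X ⟶ Y) :=
  (Ext.linearEquiv₀ (R := R) (X := X) (Y := Y)).support_eq

lemma hom_quotient_ext {I : Ideal R} {N : Type u} [AddCommGroup N] [Module R N]
    {f g : ModuleCat.of R (R ⧸ I) ⟶ ModuleCat.of R N}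
    (h : f.hom (Ideal.Quotient.mk I 1) = g.hom (Ideal.Quotient.mk I 1)) : f = g := by
  apply ModuleCat.hom_ext
  apply Submodule.linearMap_qext
  apply LinearMap.ext_ring
  exact h

variable (I : Ideal R) {N : Type u} [AddCommGroup N] [Module R N]

lemma mem_support_ext_zero_of_le [IsNoetherianRing R] {p : PrimeSpectrum R}
    (hp : p.asIdeal ∈ associatedPrimes R N) (hI : I ≤ p.asIdeal) :
    p ∈ Module.support R (Ext.{u} (ModuleCat.of R (R ⧸ I)) (ModuleCat.of R N) 0) := by
  obtain ⟨-, m, hm⟩ := mem_associatedPrimes_iff_exists.mp hp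
  rw [support_ext_zero, Module.mem_support_iff']
  refine ⟨ModuleCat.ofHom (Submodule.liftQ I (LinearMap.toSpanSingleton R N m)
    fun x hx => (hm x).mp (hI hx)), fun r hr h => hr ((hm r).mpr ?_)⟩
  have h1 := congrArg (fun f => f.hom (Ideal.Quotient.mk I 1)) h
  have h2 : r • ((1 : R) • m) = 0 := h1
  rwa [one_smul] at h2

lemma notMem_support_ext_zero {p : PrimeSpectrum R} {x : R} (hx : x ∈ I)
    (hp : p ∉ Module.support R (LinearMap.ker (LinearMap.lsmul R N x))) :
    p ∉ Module.support R (Ext.{u} (ModuleCat.of R (R ⧸ I)) (ModuleCat.of R N) 0) := by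
  rw [support_ext_zero, Module.notMem_support_iff']
  intro f
  have hf : x • f.hom (Ideal.Quotient.mk I 1) = 0 := by
    rw [← map_smul]
    have : x • (Ideal.Quotient.mk I 1) = 0 := by
      rw [← Ideal.Quotient.mk_eq_mk, ← Submodule.Quotient.mk_smul, Submodule.Quotient.mk_eq_zero]
      exact I.mul_mem_right _ hx
    rw [this, map_zero]
  obtain ⟨s, hs, h⟩ := Module.notMem_support_iff'.mp hp ⟨f.hom (Ideal.Quotient.mk I 1), hf⟩
  refine ⟨s, hs, hom_quotient_ext ?_⟩
  exact congrArg Subtype.val h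

section LongExact

variable {S : ShortComplex (ModuleCat.{u} R)} (hS : S.ShortExact) (X : ModuleCat.{u} R)
include hS

lemma ext_exact₂ (n : ℕ) : Function.Exact
    (Ext.postcompOfLinear (Ext.mk₀ S.f) R X (add_zero n))
    (Ext.postcompOfLinear (Ext.mk₀ S.g) R X (add_zero n)) := by
  intro e
  refine ⟨fun h => Ext.covariant_sequence_exact₂ X hS e h, ?_⟩
  rintro ⟨e', rfl⟩
  change (e'.comp (Ext.mk₀ S.f) (add_zero n)).comp (Ext.mk₀ S.g) (add_zero n) = 0
  simp

lemma ext_exact₃ (n : ℕ) : Function.Exact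
    (Ext.postcompOfLinear (Ext.mk₀ S.g) R X (add_zero n))
    (Ext.postcompOfLinear hS.extClass R X (rfl : n + 1 = n + 1)) := by
  intro e
  refine ⟨fun h => Ext.covariant_sequence_exact₃ X hS e rfl h, ?_⟩
  rintro ⟨e', rfl⟩
  change (e'.comp (Ext.mk₀ S.g) (add_zero n)).comp hS.extClass rfl = 0
  simp

end LongExact

section Step

variable [IsNoetherianRing R] [Module.Finite R N] {C : Type u} [AddCommGroup C] [Module R C]
  {p : PrimeSpectrum R} {x : R} (hx : x ∈ I)
  (hp : p ∉ Module.support R (LinearMap.ker (LinearMap.lsmul R N x)))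
  {g : N →ₗ[R] C} (hg : Function.Surjective g)
  (hgx : LinearMap.ker g = LinearMap.range (LinearMap.lsmul R N x))

variable (N) in
/-- `0 → (0 :_N x) → N → xN → 0`. -/
abbrev kerRangeComplex (x : R) : ShortComplex (ModuleCat.{u} R) :=
  ShortComplex.mk (ModuleCat.ofHom (LinearMap.ker (LinearMap.lsmul R N x)).subtype)
    (ModuleCat.ofHom (LinearMap.lsmul R N x).rangeRestrict) (by
      ext y
      exact y.2)

omit [IsNoetherianRing R] [Module.Finite R N] in
lemma kerRangeComplex_shortExact (x : R) : (kerRangeComplex N x).ShortExact where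
  exact := by
    rw [ShortComplex.moduleCat_exact_iff]
    intro y hy
    exact ⟨⟨y, congrArg Subtype.val hy⟩, rfl⟩
  mono_f := (ModuleCat.mono_iff_injective _).mpr Subtype.val_injective
  epi_g := (ModuleCat.epi_iff_surjective _).mpr (LinearMap.surjective_rangeRestrict _)

/-- `0 → xN → N → C → 0`, where `C` is the quotient `N / xN`. -/
abbrev rangeQuotientComplex (hgx : LinearMap.ker g = LinearMap.range (LinearMap.lsmul R N x)) :
    ShortComplex (ModuleCat.{u} R) :=
  ShortComplex.mk (ModuleCat.ofHom (LinearMap.range (LinearMap.lsmul R N x)).subtype)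
    (ModuleCat.ofHom g) (by
      ext y
      exact hgx.ge y.2)

include hg in
omit [IsNoetherianRing R] [Module.Finite R N] in
lemma rangeQuotientComplex_shortExact : (rangeQuotientComplex hgx).ShortExact where
  exact := by
    rw [ShortComplex.moduleCat_exact_iff]
    intro y hy
    exact ⟨⟨y, hgx.le hy⟩, rfl⟩
  mono_f := (ModuleCat.mono_iff_injective _).mpr Subtype.val_injective
  epi_g := (ModuleCat.epi_iff_surjective _).mpr hg

include hp hx in
/-- The composite `N → xN → N` is multiplication by `x`, which kills `Ext(R/I, N)`. Since
`N → xN` is an isomorphism at `𝔭`, the map `xN → N` induces zero on `Ext(R/I, -)` at `𝔭`. -/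
lemma exists_smul_comp_subtype_eq_zero (i : ℕ)
    (e : Ext.{u} (ModuleCat.of R (R ⧸ I))
      (ModuleCat.of R (LinearMap.range (LinearMap.lsmul R N x))) i) :
    ∃ s ∉ p.asIdeal, s • e.comp (Ext.mk₀ (ModuleCat.ofHom
      (LinearMap.range (LinearMap.lsmul R N x)).subtype)) (add_zero i) = 0 := by
  have hS := kerRangeComplex_shortExact (N := N) x
  obtain ⟨s, hs, hse⟩ := Module.notMem_support_iff'.mp
    (notMem_support_ext_right (X := ModuleCat.of R (R ⧸ I)) hp (i + 1))
    (e.comp hS.extClass rfl)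
  rw [← Ext.smul_comp] at hse
  obtain ⟨e', he'⟩ := Ext.covariant_sequence_exact₃ _ hS (s • e) rfl hse
  refine ⟨s, hs, ?_⟩
  rw [← Ext.smul_comp, ← he', Ext.comp_assoc_of_third_deg_zero, Ext.mk₀_comp_mk₀]
  have : ModuleCat.ofHom (LinearMap.lsmul R N x).rangeRestrict ≫
      ModuleCat.ofHom (LinearMap.range (LinearMap.lsmul R N x)).subtype =
      x • 𝟙 (ModuleCat.of R N) := by
    ext y; rfl
  rw [this, ← Ext.smul_eq_comp_mk₀]
  exact smul_ext_quotient_eq_zero I hx e'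

include hp hx hg hgx in
/-- At `𝔭`, the group `Ext^i(R/I, C)` surjects onto `Ext^{i+1}(R/I, xN)`, which is isomorphic to
`Ext^{i+1}(R/I, N)`. -/
lemma notMem_support_ext_succ (i : ℕ)
    (hC : p ∉ Module.support R (Ext.{u} (ModuleCat.of R (R ⧸ I)) (ModuleCat.of R C) i)) :
    p ∉ Module.support R (Ext.{u} (ModuleCat.of R (R ⧸ I)) (ModuleCat.of R N) (i + 1)) := by
  have hS := kerRangeComplex_shortExact (N := N) x
  refine notMem_support_of_exact (ext_exact₂ hS (ModuleCat.of R (R ⧸ I)) (i + 1))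
    (notMem_support_ext_right hp _) ?_
  have hT := rangeQuotientComplex_shortExact hg hgx
  refine Module.notMem_support_iff'.mpr fun e => ?_
  obtain ⟨s, hs, hse⟩ := exists_smul_comp_subtype_eq_zero I hx hp (i + 1) e
  rw [← Ext.smul_comp] at hse
  obtain ⟨c, hc⟩ := Ext.covariant_sequence_exact₁ _ hT (s • e) hse rfl
  obtain ⟨t, ht, htc⟩ := Module.notMem_support_iff'.mp hC c
  refine ⟨t * s, fun hts => (p.2.mem_or_mem hts).elim ht hs, ?_⟩
  have h : t • s • e = (t • c).comp hT.extClass rfl := by rw [Ext.smul_comp, hc]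
  rw [mul_smul, h, htc, Ext.zero_comp]

include hp hg hgx in
/-- At `𝔭`, the sequence `Ext^i(R/I, N) → Ext^i(R/I, C) → Ext^{i+1}(R/I, xN)` is exact, and its
last term is isomorphic to `Ext^{i+1}(R/I, N)`. -/
lemma mem_support_ext_succ (i : ℕ)
    (hN : p ∉ Module.support R (Ext.{u} (ModuleCat.of R (R ⧸ I)) (ModuleCat.of R N) i))
    (hC : p ∈ Module.support R (Ext.{u} (ModuleCat.of R (R ⧸ I)) (ModuleCat.of R C) i)) :
    p ∈ Module.support R (Ext.{u} (ModuleCat.of R (R ⧸ I)) (ModuleCat.of R N) (i + 1)) := by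
  by_contra h
  have hS := kerRangeComplex_shortExact (N := N) x
  have hT := rangeQuotientComplex_shortExact hg hgx
  refine notMem_support_of_exact (ext_exact₃ hT (ModuleCat.of R (R ⧸ I)) i) hN ?_ hC
  exact notMem_support_of_exact (ext_exact₃ hS (ModuleCat.of R (R ⧸ I)) (i + 1)) h
    (notMem_support_ext_right hp _)

end Step

end ExtStep

/-! ### Sequences in dimension `> k` and Ext modules -/

section Depth

variable {R : Type u} [CommRing R]

/-- `N / (xs, x) N` is the quotient of `N / (xs) N` by the multiples of `x`. -/
lemma exists_factor_append_singleton (N : Type u) [AddCommGroup N] [Module R N] (xs : List R)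
    (x : R) :
    ∃ g : (N ⧸ (Ideal.ofList xs • (⊤ : Submodule R N))) →ₗ[R]
        (N ⧸ (Ideal.ofList (xs ++ [x]) • (⊤ : Submodule R N))),
      Function.Surjective g ∧ LinearMap.ker g = LinearMap.range (LinearMap.lsmul R _ x) := by
  have hle : Ideal.ofList xs • (⊤ : Submodule R N) ≤ Ideal.ofList (xs ++ [x]) • ⊤ := by
    rw [Ideal.ofList_append]
    exact Submodule.smul_mono_left le_sup_left
  refine ⟨Submodule.factor hle, Submodule.factor_surjective hle, ?_⟩
  ext y
  obtain ⟨y, rfl⟩ := Submodule.Quotient.mk_surjective _ y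
  rw [LinearMap.mem_ker]
  change Submodule.Quotient.mk y = 0 ↔ _
  rw [Submodule.Quotient.mk_eq_zero, Ideal.ofList_append, Ideal.ofList_singleton,
    Submodule.sup_smul, Submodule.mem_sup]
  constructor
  · rintro ⟨a, ha, b, hb, rfl⟩
    rw [Submodule.ideal_span_singleton_smul] at hb
    obtain ⟨c, -, rfl⟩ := Submodule.mem_smul_pointwise_iff_exists _ _ _ |>.mp hb
    refine ⟨Submodule.Quotient.mk c, ?_⟩
    rw [Submodule.Quotient.mk_add, (Submodule.Quotient.mk_eq_zero _).mpr ha, zero_add]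
    rfl
  · rintro ⟨z, hz⟩
    obtain ⟨z, rfl⟩ := Submodule.Quotient.mk_surjective _ z
    refine ⟨y - x • z, ?_, x • z, ?_, sub_add_cancel _ _⟩
    · exact (Submodule.Quotient.eq _).mp hz.symm
    · exact Submodule.smul_mem_smul (Ideal.mem_span_singleton_self x) trivial

lemma support_ext_subset_of_linearEquiv {X : ModuleCat.{u} R} {A B : Type u} [AddCommGroup A]
    [Module R A] [AddCommGroup B] [Module R B] (e : A ≃ₗ[R] B) (i : ℕ) :
    Module.support R (Abelian.Ext.{u} X (ModuleCat.of R A) i) ⊆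
      Module.support R (Abelian.Ext.{u} X (ModuleCat.of R B) i) := by
  refine Module.support_subset_of_injective (Abelian.Ext.postcompOfLinear
    (Abelian.Ext.mk₀ e.toModuleIso.hom) R X (add_zero i))
    (Function.LeftInverse.injective
      (g := fun a => a.comp (Abelian.Ext.mk₀ e.toModuleIso.inv) (add_zero i)) fun a => ?_)
  change (a.comp (Abelian.Ext.mk₀ e.toModuleIso.hom) (add_zero i)).comp
    (Abelian.Ext.mk₀ e.toModuleIso.inv) (add_zero i) = a
  rw [Abelian.Ext.comp_assoc_of_third_deg_zero, Abelian.Ext.mk₀_comp_mk₀, Iso.hom_inv_id,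
    Abelian.Ext.comp_mk₀_id]

variable [IsNoetherianRing R] (I : Ideal R) (N : Type u) [AddCommGroup N] [Module R N]
  [Module.Finite R N]

/-- If `xs` is a weakly regular sequence in `I` on `N_𝔭`, then passing from `N` to `N / (xs) N`
lowers the first index with `Ext(R/I, -)_𝔭 ≠ 0` by the length of `xs`. -/
lemma support_ext_of_list {p : PrimeSpectrum R} (xs : List R) (hI : ∀ x ∈ xs, x ∈ I)
    (hxs : ∀ (i : ℕ) (hi : i < xs.length),
      ∀ q ∈ associatedPrimes R (N ⧸ (Ideal.ofList (xs.take i) • (⊤ : Submodule R N))),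
        q ≤ p.asIdeal → xs[i] ∉ q) (d : ℕ)
    (hd : ∀ i < d, p ∉ Module.support R (Abelian.Ext.{u} (ModuleCat.of R (R ⧸ I))
      (ModuleCat.of R (N ⧸ (Ideal.ofList xs • (⊤ : Submodule R N)))) i)) :
    (∀ i < d + xs.length, p ∉ Module.support R
      (Abelian.Ext.{u} (ModuleCat.of R (R ⧸ I)) (ModuleCat.of R N) i)) ∧
    (p ∈ Module.support R (Abelian.Ext.{u} (ModuleCat.of R (R ⧸ I))
      (ModuleCat.of R (N ⧸ (Ideal.ofList xs • (⊤ : Submodule R N)))) d) →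
      p ∈ Module.support R
        (Abelian.Ext.{u} (ModuleCat.of R (R ⧸ I)) (ModuleCat.of R N) (d + xs.length))) := by
  induction xs using List.reverseRecOn generalizing d with
  | nil =>
    have e : (N ⧸ (Ideal.ofList ([] : List R) • (⊤ : Submodule R N))) ≃ₗ[R] N :=
      Submodule.quotEquivOfEqBot _ (by simp)
    have h (i : ℕ) : Module.support R (Abelian.Ext.{u} (ModuleCat.of R (R ⧸ I))
        (ModuleCat.of R (N ⧸ (Ideal.ofList ([] : List R) • (⊤ : Submodule R N)))) i) =
        Module.support R (Abelian.Ext.{u} (ModuleCat.of R (R ⧸ I)) (ModuleCat.of R N) i) :=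
      (support_ext_subset_of_linearEquiv e i).antisymm
        (support_ext_subset_of_linearEquiv e.symm i)
    simp only [h] at hd ⊢
    exact ⟨hd, id⟩
  | append_singleton xs x ih =>
    obtain ⟨g, hg, hgx⟩ := exists_factor_append_singleton N xs x
    have hx : x ∈ I := hI x (by simp)
    have hp : p ∉ Module.support R (LinearMap.ker (LinearMap.lsmul R
        (N ⧸ (Ideal.ofList xs • (⊤ : Submodule R N))) x)) := by
      have := hxs xs.length (by simp)
      rw [List.take_left, List.getElem_concat_length rfl] at this
      exact notMem_support_ker_lsmul this
    have hsmall : ∀ i < d + 1, p ∉ Module.support R (Abelian.Ext.{u} (ModuleCat.of R (R ⧸ I))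
        (ModuleCat.of R (N ⧸ (Ideal.ofList xs • (⊤ : Submodule R N)))) i) := by
      rintro (_ | i) hi
      · exact notMem_support_ext_zero I hx hp
      · exact notMem_support_ext_succ I hx hp hg hgx i (hd i (by omega))
    obtain ⟨h1, h2⟩ := ih (fun y hy => hI y (by simp [hy])) (fun i hi => by
      have := hxs i (by simp; omega)
      rwa [List.take_append_of_le_length hi.le, List.getElem_append_left hi] at this) _ hsmall
    rw [List.length_append, List.length_singleton, add_comm xs.length, ← add_assoc]
    exact ⟨h1, fun hC => h2 (mem_support_ext_succ I hp hg hgx d (hsmall d (by omega)) hC)⟩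

variable {I N} {k : ℤ}

omit [IsNoetherianRing R] [Module.Finite R N] in
lemma dimGT_extDim_iff {i : ℕ} :
    DimGT k (extDim I N i) ↔ ∃ p ∈ Module.support R
      (Abelian.Ext.{u} (ModuleCat.of R (R ⧸ I)) (ModuleCat.of R N) i),
      DimGT k (ringKrullDim (R ⧸ p.asIdeal)) :=
  dimGT_supportDim_iff

omit [IsNoetherianRing R] in
lemma not_dimGT_extDim_of_not_dimGT
    (h : ¬ DimGT k (Module.supportDim R (N ⧸ (I • (⊤ : Submodule R N))))) (i : ℕ) :
    ¬ DimGT k (extDim I N i) := by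
  rw [dimGT_extDim_iff]
  rintro ⟨p, hp, hk⟩
  exact h (dimGT_supportDim_iff.mpr ⟨p, support_ext_subset I N i hp, hk⟩)

variable [IsLocalRing R]

lemma IsSeqInDimGT.not_dimGT_extDim {xs : List R} (h : IsSeqInDimGT k N xs)
    (hI : ∀ x ∈ xs, x ∈ I) {i : ℕ} (hi : i < xs.length) : ¬ DimGT k (extDim I N i) := by
  rw [dimGT_extDim_iff]
  rintro ⟨p, hp, hk⟩
  exact (support_ext_of_list I N xs hI (fun j hj q hq hqp => h.2 j hj q hq (hk.quotient_anti hqp))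
    0 (by simp)).1 i (by omega) hp

omit [Module.Finite R N] [IsNoetherianRing R] in
lemma isSeqInDimGT_append_singleton_iff {xs : List R} {x : R} :
    IsSeqInDimGT k N (xs ++ [x]) ↔ IsSeqInDimGT k N xs ∧ x ∈ IsLocalRing.maximalIdeal R ∧
      ∀ p ∈ associatedPrimes R (N ⧸ (Ideal.ofList xs • (⊤ : Submodule R N))),
        DimGT k (ringKrullDim (R ⧸ p)) → x ∉ p := by
  constructor
  · rintro ⟨h1, h2⟩
    refine ⟨⟨fun y hy => h1 y (by simp [hy]), fun i hi => ?_⟩, h1 x (by simp), ?_⟩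
    · have := h2 i (by simp; omega)
      rwa [List.take_append_of_le_length hi.le, List.getElem_append_left hi] at this
    · have := h2 xs.length (by simp)
      rwa [List.take_left, List.getElem_concat_length rfl] at this
  · rintro ⟨⟨h1, h2⟩, hx, h3⟩
    refine ⟨fun y hy => ?_, fun i hi => ?_⟩
    · rcases List.mem_append.mp hy with hy | hy
      · exact h1 y hy
      · rwa [List.mem_singleton.mp hy]
    · rcases Nat.lt_or_ge i xs.length with hi' | hi'
      · rw [List.take_append_of_le_length hi'.le, List.getElem_append_left hi']
        exact h2 i hi'
      · obtain rfl : i = xs.length := by simp at hi; omega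
        rwa [List.take_left, List.getElem_concat_length rfl]

/-- By prime avoidance, a maximal sequence `xs` in `I` comes with an associated prime `𝔮 ⊇ I` of
`N / (xs) N` with `dim R / 𝔮 > k`, so that `Hom(R/I, N / (xs) N)_𝔮 ≠ 0`. -/
lemma IsMaxSeqInDimGT.dimGT_extDim {xs : List R} (h : IsMaxSeqInDimGT k I N xs)
    (hIm : I ≤ IsLocalRing.maximalIdeal R) : DimGT k (extDim I N xs.length) := by
  obtain ⟨hI, hseq, hmax⟩ := h
  let A := associatedPrimes R (N ⧸ (Ideal.ofList xs • (⊤ : Submodule R N)))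
  have hfin : {q ∈ A | DimGT k (ringKrullDim (R ⧸ q))}.Finite :=
    (associatedPrimes.finite R _).subset (Set.sep_subset _ _)
  have hsub : (I : Set R) ⊆ ⋃ q ∈ (hfin.toFinset : Set (Ideal R)), (q : Set R) := by
    intro x hx
    have := hmax x hx
    rw [isSeqInDimGT_append_singleton_iff] at this
    push Not at this
    obtain ⟨q, hq, hk, hxq⟩ := this hseq (hIm hx)
    simp only [Set.Finite.coe_toFinset, Set.mem_iUnion]
    exact ⟨q, ⟨hq, hk⟩, hxq⟩
  obtain ⟨q, hq, hIq⟩ := (Ideal.subset_union_prime ⊥ ⊥ (fun q hq _ _ =>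
    ((hfin.mem_toFinset.mp hq).1 : IsAssociatedPrime q _).isPrime)).mp hsub
  obtain ⟨hqA, hk⟩ := hfin.mem_toFinset.mp hq
  refine dimGT_extDim_iff.mpr ⟨⟨q, hqA.1⟩, ?_, hk⟩
  have := (support_ext_of_list I N (p := ⟨q, hqA.1⟩) xs hI
    (fun j hj q hq hqp => hseq.2 j hj q hq (hk.quotient_anti hqp)) 0 (by simp)).2
    (mem_support_ext_zero_of_le I hqA hIq)
  rwa [zero_add] at this

omit [IsNoetherianRing R] [Module.Finite R N] in
lemma le_maximalIdeal_of_dimGT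
    (h : DimGT k (Module.supportDim R (N ⧸ (I • (⊤ : Submodule R N))))) :
    I ≤ IsLocalRing.maximalIdeal R := by
  refine IsLocalRing.le_maximalIdeal ?_
  rintro rfl
  obtain ⟨j, -, hj⟩ := h
  have : Subsingleton (N ⧸ ((⊤ : Ideal R) • (⊤ : Submodule R N))) := by
    rw [Submodule.Quotient.subsingleton_iff, Submodule.top_smul]
  rw [Module.supportDim_eq_bot_of_subsingleton] at hj
  simp at hj

/-- All maximal sequences have the same length, namely the first index `i` with
`dim Ext^i(R/I, N) > k`. -/
lemma IsMaxSeqInDimGT.isDepthInDimGT {xs : List R} (h : IsMaxSeqInDimGT k I N xs)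
    (hN : DimGT k (Module.supportDim R (N ⧸ (I • (⊤ : Submodule R N))))) :
    IsDepthInDimGT k I N xs.length := by
  have hIm := le_maximalIdeal_of_dimGT hN
  refine Or.inl ⟨hN, ⟨xs, h⟩, fun ys hys => ?_⟩
  rcases lt_trichotomy ys.length xs.length with hlt | heq | hlt
  · exact absurd (hys.dimGT_extDim hIm) (h.2.1.not_dimGT_extDim h.1 hlt)
  · rw [heq]
  · exact absurd (h.dimGT_extDim hIm) (hys.2.1.not_dimGT_extDim hys.1 hlt)

end Depth

/-! ### Families with stable associated primes -/

section Family

/-- All quotients `N n / 𝔞 (N n)` have sets of associated primes that do not depend on `n` for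
large `n`. -/
def HasStableAssociatedPrimes (R : Type u) [CommRing R] (N : ℕ → Type u)
    [∀ n, AddCommGroup (N n)] [∀ n, Module R (N n)] : Prop :=
  ∀ a : Ideal R, ∃ A : Set (Ideal R),
    ∀ᶠ n in atTop, associatedPrimes R (N n ⧸ (a • (⊤ : Submodule R (N n)))) = A

variable {R : Type u} [CommRing R] [IsLocalRing R] [IsNoetherianRing R] {I : Ideal R} {k : ℤ}
  {N : ℕ → Type u} [∀ n, AddCommGroup (N n)] [∀ n, Module R (N n)]

/-- A single sequence is maximal for `N n` for all large `n`: among the sequences that work for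
all large `n`, one that generates a maximal ideal cannot be prolonged. -/
lemma HasStableAssociatedPrimes.exists_isMaxSeqInDimGT (h : HasStableAssociatedPrimes R N)
    (hN : ∀ᶠ n in atTop, DimGT k (Module.supportDim R (N n ⧸ (I • (⊤ : Submodule R (N n)))))) :
    ∃ xs : List R, ∀ᶠ n in atTop, IsMaxSeqInDimGT k I (N n) xs := by
  have hIm : I ≤ IsLocalRing.maximalIdeal R := hN.exists.elim fun n => le_maximalIdeal_of_dimGT
  obtain ⟨_, ⟨xs, ⟨hI, hseq⟩, rfl⟩, hmax⟩ := set_has_maximal_iff_noetherian.mpr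
    (inferInstanceAs (IsNoetherian R R))
    (Ideal.ofList '' {xs | (∀ x ∈ xs, x ∈ I) ∧ ∀ᶠ n in atTop, IsSeqInDimGT k (N n) xs})
    ⟨_, [], ⟨by simp, Eventually.of_forall fun n => ⟨by simp, by simp⟩⟩, rfl⟩
  obtain ⟨A, hA⟩ := h (Ideal.ofList xs)
  have hxsI : Ideal.ofList xs ≤ I := Ideal.span_le.mpr hI
  -- Every element of `I` lies in a prime of `A` of large dimension.
  have key : ∀ x ∈ I, ∃ q ∈ A, DimGT k (ringKrullDim (R ⧸ q)) ∧ x ∈ q := by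
    intro x hx
    by_contra! hcon
    have hseq' : ∀ᶠ n in atTop, IsSeqInDimGT k (N n) (xs ++ [x]) := by
      filter_upwards [hseq, hA] with n hn hAn
      exact isSeqInDimGT_append_singleton_iff.mpr ⟨hn, hIm hx, fun q hq => hcon q (hAn ▸ hq)⟩
    have hI' : ∀ y ∈ xs ++ [x], y ∈ I := by
      intro y hy
      rcases List.mem_append.mp hy with hy | hy
      · exact hI y hy
      · rwa [List.mem_singleton.mp hy]
    -- By maximality `x ∈ (xs)`, so that `x` lies in every associated prime of `N n / (xs) (N n)`.
    have hxmem : x ∈ Ideal.ofList xs := by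
      by_contra hxn
      refine hmax _ ⟨xs ++ [x], ⟨hI', hseq'⟩, rfl⟩ (lt_of_le_of_ne ?_ ?_)
      · rw [Ideal.ofList_append]; exact le_sup_left
      · intro heq
        exact hxn (heq.ge (Ideal.subset_span (by simp)))
    obtain ⟨n, hn, hAn⟩ := (hN.and hA).exists
    have hle : Ideal.ofList xs • (⊤ : Submodule R (N n)) ≤ I • ⊤ :=
      Submodule.smul_mono_left hxsI
    have hdim : DimGT k (Module.supportDim R
        (N n ⧸ (Ideal.ofList xs • (⊤ : Submodule R (N n))))) := by
      obtain ⟨j, hkj, hj⟩ := hn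
      exact ⟨j, hkj, hj.trans (Module.supportDim_le_of_surjective _
        (Submodule.factor_surjective hle))⟩
    obtain ⟨q, hq, hk⟩ := dimGT_supportDim_iff_associatedPrimes.mp hdim
    refine hcon q (hAn ▸ hq) hk ?_
    obtain ⟨-, m, hm⟩ := mem_associatedPrimes_iff_exists.mp hq
    obtain ⟨m, rfl⟩ := Submodule.Quotient.mk_surjective _ m
    rw [hm, ← Submodule.Quotient.mk_smul, Submodule.Quotient.mk_eq_zero]
    exact Submodule.smul_mem_smul hxmem trivial
  refine ⟨xs, ?_⟩
  filter_upwards [hseq, hA] with n hn hAn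
  refine ⟨hI, hn, fun x hx hx' => ?_⟩
  obtain ⟨q, hq, hk, hxq⟩ := key x hx
  exact (isSeqInDimGT_append_singleton_iff.mp hx').2.2 q (hAn ▸ hq) hk hxq

/-- The associated primes of `N n / I (N n)` decide, uniformly for large `n`, whether the depth is
infinite; if not, it is the length of a common maximal sequence. -/
theorem HasStableAssociatedPrimes.exists_eventually_isDepthInDimGT [∀ n, Module.Finite R (N n)]
    (h : HasStableAssociatedPrimes R N) (I : Ideal R) (k : ℤ) :
    ∃ r : ℕ∞, (∀ᶠ n in atTop, IsDepthInDimGT k I (N n) r) ∧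
      r = sInf ((fun i : ℕ => (i : ℕ∞)) ''
        {i : ℕ | {n : ℕ | DimGT k (extDim I (N n) i)}.Infinite}) := by
  simp only [← Nat.frequently_atTop_iff_infinite]
  obtain ⟨A, hA⟩ := h I
  by_cases hk : ∃ p ∈ A, DimGT k (ringKrullDim (R ⧸ p))
  · have hN : ∀ᶠ n in atTop,
        DimGT k (Module.supportDim R (N n ⧸ (I • (⊤ : Submodule R (N n))))) := by
      filter_upwards [hA] with n hn
      rwa [dimGT_supportDim_iff_associatedPrimes, hn]
    have hIm : I ≤ IsLocalRing.maximalIdeal R := hN.exists.elim fun n => le_maximalIdeal_of_dimGT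
    obtain ⟨xs, hxs⟩ := h.exists_isMaxSeqInDimGT hN
    refine ⟨xs.length, ?_, le_antisymm ?_ ?_⟩
    · filter_upwards [hxs, hN] with n hn hNn
      exact hn.isDepthInDimGT hNn
    · refine le_sInf ?_
      rintro _ ⟨i, hi, rfl⟩
      obtain ⟨n, hi, hn⟩ := (hi.and_eventually hxs).exists
      exact Nat.cast_le.mpr (not_lt.mp fun hlt => hn.2.1.not_dimGT_extDim hn.1 hlt hi)
    · exact sInf_le ⟨_, (hxs.mono fun n hn => hn.dimGT_extDim hIm).frequently, rfl⟩
  · have hN : ∀ᶠ n in atTop,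
        ¬ DimGT k (Module.supportDim R (N n ⧸ (I • (⊤ : Submodule R (N n))))) := by
      filter_upwards [hA] with n hn
      rwa [dimGT_supportDim_iff_associatedPrimes, hn]
    refine ⟨⊤, hN.mono fun n hn => Or.inr ⟨hn, rfl⟩, ?_⟩
    rw [eq_comm, sInf_eq_top]
    rintro _ ⟨i, hi, rfl⟩
    obtain ⟨n, hi, hn⟩ := (hi.and_eventually hN).exists
    exact absurd hi (not_dimGT_extDim_of_not_dimGT hn i)

end Family

/-! ### Associated primes of graded components -/

section Stability

/-- An increasing sequence of subsets of a finite set is eventually constant. -/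
lemma exists_eventually_eq_of_subset {α : Type*} {X : ℕ → Set α} {B : Set α} (hB : B.Finite)
    (hX : ∀ᶠ n in atTop, X n ⊆ B) (hmono : ∀ᶠ n in atTop, X n ⊆ X (n + 1)) :
    ∃ A, ∀ᶠ n in atTop, X n = A := by
  obtain ⟨n₀, h⟩ := eventually_atTop.mp (hX.and hmono)
  have hmon : Monotone fun n => X (n₀ + n) :=
    monotone_nat_of_le_succ fun n => (h (n₀ + n) (by omega)).2
  have hfin : (Set.range fun n => X (n₀ + n)).Finite :=
    hB.finite_subsets.subset (by rintro _ ⟨n, rfl⟩; exact (h (n₀ + n) (by omega)).1)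
  obtain ⟨_, ⟨m, rfl⟩, hm⟩ := hfin.exists_maximal (Set.range_nonempty _)
  refine ⟨X (n₀ + m), eventually_atTop.mpr ⟨n₀ + m, fun n hn => ?_⟩⟩
  obtain ⟨l, rfl⟩ := Nat.exists_eq_add_of_le (show n₀ ≤ n by omega)
  exact ((hm ⟨l, rfl⟩ (hmon (by omega))).antisymm (hmon (by omega)))

variable {R S E : Type*} [CommRing R] [CommRing S] [Algebra R S] [AddCommGroup E] [Module R E]
  [Module S E] [IsScalarTower R S E]

/-- If `𝔭` is the annihilator of `m` over `R`, it is the contraction of a minimal prime over the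
annihilator of `m` over `S`. -/
lemma associatedPrimes_subset_comap [IsNoetherianRing R] [IsNoetherianRing S] :
    associatedPrimes R E ⊆ Ideal.comap (algebraMap R S) '' associatedPrimes S E := by
  intro p hp
  obtain ⟨hpp, m, hm⟩ := mem_associatedPrimes_iff_exists.mp hp
  have hcomap : (Module.annihilator S (S ∙ m)).comap (algebraMap R S) = p := by
    ext r
    rw [Ideal.mem_comap, hm]
    change _ ∈ (S ∙ m).annihilator ↔ _
    rw [Submodule.mem_annihilator_span_singleton, algebraMap_smul]
  obtain ⟨q, hq, hqp⟩ := Ideal.exists_minimalPrimes_comap_eq (algebraMap R S)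
    (I := Module.annihilator S (S ∙ m)) p (by
      rw [hcomap, Ideal.minimalPrimes_eq_subsingleton_self]; rfl)
  exact ⟨q, associatedPrimes.subset_of_injective (f := (S ∙ m).subtype) Subtype.val_injective
    (Module.associatedPrimes.minimalPrimes_annihilator_subset_associatedPrimes S _ hq), hqp⟩

/-- Let `S` be generated as an `R`-module by `1` and the ideal `(T)`, with `T` finite, and let
`N n` be the components of a finitely generated `S`-module, with `T (N n) ⊆ N (n + 1)`. The
elements killed by `T` form a finitely generated `R`-module, so they do not meet `N n` for large
`n`; then `Ass (N n) ⊆ Ass (N (n + 1))`, and all these sets lie in the finite set of contractions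
of the associated primes over `S`. -/
theorem exists_eventually_associatedPrimes_eq [IsNoetherianRing R] [IsNoetherianRing S]
    [Module.Finite S E] (T : Finset S)
    (hT : ∀ s : S, ∃ r : R, s - algebraMap R S r ∈ Ideal.span (T : Set S))
    (N : ℕ → Submodule R E) (hN : ∀ n, ∀ t ∈ T, ∀ y ∈ N n, t • y ∈ N (n + 1))
    (hfg : ∀ F : Submodule R E, F.FG → ∀ᶠ n in atTop, Disjoint (N n) F) :
    ∃ A : Set (Ideal R), ∀ᶠ n in atTop, associatedPrimes R (N n) = A := by
  refine exists_eventually_eq_of_subset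
    ((associatedPrimes.finite S E).image (Ideal.comap (algebraMap R S)))
    (Eventually.of_forall fun n => (associatedPrimes.subset_of_injective
      (f := (N n).subtype) Subtype.val_injective).trans associatedPrimes_subset_comap) ?_
  -- `K` consists of the elements killed by `T`; on it, `S` acts through `R`.
  let K : Submodule S E := ⨅ t ∈ T, LinearMap.ker (LinearMap.lsmul S E t)
  have hKmem (y : E) : y ∈ K ↔ ∀ t ∈ T, t • y = 0 := by simp [K]
  have hKann : ∀ s ∈ Ideal.span (T : Set S), ∀ y ∈ K, s • y = 0 := by
    intro s hs y hy
    have hle : Ideal.span (T : Set S) ≤ (S ∙ y).annihilator := Ideal.span_le.mpr fun t ht =>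
      (Submodule.mem_annihilator_span_singleton _ _).mpr ((hKmem y).mp hy t ht)
    exact (Submodule.mem_annihilator_span_singleton _ _).mp (hle hs)
  have hKfg : (K.restrictScalars R).FG := by
    obtain ⟨G, hG⟩ : K.FG := IsNoetherian.noetherian K
    refine ⟨G, le_antisymm ?_ ?_⟩
    · rw [Submodule.span_le]
      exact fun y hy => hG.le (Submodule.subset_span hy)
    · intro y hy
      have hy' : y ∈ Submodule.span S (G : Set E) := hG.ge hy
      clear hy
      induction hy' using Submodule.span_induction with
      | mem y hy => exact Submodule.subset_span hy
      | zero => exact zero_mem _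
      | add y z hy hz ihy ihz => exact add_mem ihy ihz
      | smul s y hy ih =>
        obtain ⟨r, hr⟩ := hT s
        have : s • y = r • y := by
          rw [← algebraMap_smul S r y, ← sub_eq_zero, ← sub_smul]
          exact hKann _ hr y (hG.le hy)
        rw [this]
        exact Submodule.smul_mem _ _ ih
  filter_upwards [hfg _ hKfg] with n hn
  intro p hp
  obtain ⟨hpp, ⟨m, hmn⟩, hm⟩ := mem_associatedPrimes_iff_exists.mp hp
  -- A prime containing a finite intersection contains one of the ideals, so that `p` is the
  -- annihilator of some `t • m`.
  have hle : T.inf (fun t => (R ∙ (t • m)).annihilator) ≤ p := by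
    intro r hr
    rw [hm]
    refine Subtype.ext (Submodule.disjoint_def.mp hn _ ((N n).smul_mem r hmn) ?_)
    refine (hKmem _).mpr fun t ht => ?_
    have := (Submodule.mem_annihilator_span_singleton _ _).mp 
      (Finset.inf_le (f := fun t => (R ∙ (t • m)).annihilator) ht hr)
    change t • r • m = 0
    rwa [smul_comm]
  obtain ⟨t, ht, htp⟩ := (Ideal.IsPrime.inf_le' hpp).mp hle
  refine mem_associatedPrimes_iff_exists.mpr ⟨hpp, ⟨t • m, hN n t ht m hmn⟩, fun r => ?_⟩
  rw [Subtype.ext_iff]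
  change _ ↔ r • t • m = 0
  constructor
  · intro hr
    have h0 : r • m = 0 := congrArg Subtype.val ((hm r).mp hr)
    rw [smul_comm, h0, smul_zero]
  · exact fun h => htp ((Submodule.mem_annihilator_span_singleton _ _).mpr h)

variable {L Q : ℕ → Type*} [∀ n, AddCommGroup (L n)] [∀ n, Module R (L n)]
  [∀ n, AddCommGroup (Q n)] [∀ n, Module R (Q n)]

/-- The stability theorem for a subquotient of an `S`-module `E`: the components, modulo `B`, of a
finitely generated submodule `A` are the images of maps `φ n`, and they are detected by coordinate
maps `ψ n`, almost all of which vanish at any given element. -/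
theorem exists_eventually_associatedPrimes_quotient_comap_eq [IsNoetherianRing R]
    [IsNoetherianRing S] (A B : Submodule S E) [Module.Finite S A] (T : Finset S)
    (hT : ∀ s : S, ∃ r : R, s - algebraMap R S r ∈ Ideal.span (T : Set S))
    (φ : ∀ n, L n →ₗ[R] E) (hφA : ∀ n y, φ n y ∈ A)
    (hφ : ∀ n, ∀ t ∈ T, ∀ y, ∃ z, φ (n + 1) z - t • φ n y ∈ B)
    (ψ : ∀ n, E →ₗ[R] Q n) (hψB : ∀ n, ∀ b ∈ B, ψ n b = 0)
    (hψφ : ∀ n y, ψ n (φ n y) = 0 → φ n y ∈ B) (hψ : ∀ e, ∀ᶠ n in atTop, ψ n e = 0) :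
    ∃ X : Set (Ideal R), ∀ᶠ n in atTop,
      associatedPrimes R (L n ⧸ (B.restrictScalars R).comap (φ n)) = X := by
  let B' : Submodule S A := B.comap A.subtype
  let φ' (n : ℕ) : L n →ₗ[R] A ⧸ B' :=
    B'.mkQ.restrictScalars R ∘ₗ (φ n).codRestrict (A.restrictScalars R) (hφA n)
  have hφ'0 (n : ℕ) (y : L n) : φ' n y = 0 ↔ φ n y ∈ B := Submodule.Quotient.mk_eq_zero B'
  let ψ' (n : ℕ) : A ⧸ B' →ₗ[R] Q n :=
    (B'.restrictScalars R).liftQ (ψ n ∘ₗ A.subtype.restrictScalars R)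
      (fun b hb => hψB n b hb) ∘ₗ (Submodule.Quotient.restrictScalarsEquiv R B').symm.toLinearMap
  have hψ' (n : ℕ) (a : A) : ψ' n (Submodule.Quotient.mk a) = ψ n a := rfl
  obtain ⟨X, hX⟩ := exists_eventually_associatedPrimes_eq T hT (fun n => LinearMap.range (φ' n))
    (by
      rintro n t ht _ ⟨y, rfl⟩
      obtain ⟨z, hz⟩ := hφ n t ht y
      exact ⟨z, (Submodule.Quotient.eq B').mpr hz⟩) (by
      rintro _ ⟨G, rfl⟩
      have hG : ∀ᶠ n in atTop, ∀ g ∈ G, ψ' n g = 0 := by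
        refine (eventually_all_finset G).mpr fun g _ => ?_
        obtain ⟨a, rfl⟩ := Submodule.Quotient.mk_surjective _ g
        exact hψ a
      filter_upwards [hG] with n hn
      rw [Submodule.disjoint_def]
      rintro _ ⟨y, rfl⟩ hy
      exact (hφ'0 n y).mpr (hψφ n y
        ((Submodule.span_le (p := LinearMap.ker (ψ' n))).mpr hn hy)))
  refine ⟨X, hX.mono fun n hn => hn ▸ LinearEquiv.AssociatedPrimes.eq
    ((Submodule.quotEquivOfEq _ _ ?_).trans (φ' n).quotKerEquivRange)⟩
  ext y
  exact (hφ'0 n y).symm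

/-- If `X` generates the algebra `S`, then `S` is generated as an `R`-module by `1` and finitely
many elements of `X` generating the same ideal as `X`. -/
lemma exists_finset_sub_algebraMap_mem_span [IsNoetherianRing S] {X : Set S}
    (hX : Algebra.adjoin R X = ⊤) :
    ∃ T : Finset S, (T : Set S) ⊆ X ∧
      ∀ s : S, ∃ r : R, s - algebraMap R S r ∈ Ideal.span (T : Set S) := by
  obtain ⟨T, hTX, hT⟩ := (Submodule.fg_span_iff_fg_span_finset_subset X).mp
    (IsNoetherian.noetherian (Ideal.span X))
  refine ⟨T, hTX, fun s => ?_⟩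
  change ∃ r : R, s - algebraMap R S r ∈ Submodule.span S (T : Set S)
  rw [← hT]
  have hs : s ∈ Algebra.adjoin R X := hX ▸ trivial
  induction hs using Algebra.adjoin_induction with
  | mem x hx => exact ⟨0, by simpa using Submodule.subset_span hx⟩
  | algebraMap r => exact ⟨r, by simp⟩
  | add x y _ _ hx hy =>
    obtain ⟨a, ha⟩ := hx
    obtain ⟨b, hb⟩ := hy
    refine ⟨a + b, ?_⟩
    rw [map_add, add_sub_add_comm]
    exact add_mem ha hb
  | mul x y _ _ hx hy =>
    obtain ⟨a, ha⟩ := hx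
    obtain ⟨b, hb⟩ := hy
    refine ⟨a * b, ?_⟩
    have : x * y - algebraMap R S (a * b) =
        x • (y - algebraMap R S b) + algebraMap R S b • (x - algebraMap R S a) := by
      simp only [map_mul, smul_eq_mul]; ring
    rw [this]
    exact add_mem (Submodule.smul_mem _ _ hb) (Submodule.smul_mem _ _ ha)

end Stability

/-! ### Components of a graded module -/

section Graded

variable {R S : Type u} [CommRing R] [CommRing S] [Algebra R S] {𝒜 : ℕ → Submodule R S}
  {E : Type u} [AddCommGroup E] [Module R E] [Module S E]
  (ℳ : ℕ → Submodule R E) [DirectSum.Decomposition ℳ]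

/-- The projection of a graded module onto its component of degree `n`. -/
def gradedComponent (n : ℕ) : E →ₗ[R] ℳ n :=
  DirectSum.component R ℕ (fun i => ℳ i) n ∘ₗ (DirectSum.decomposeLinearEquiv ℳ).toLinearMap

lemma gradedComponent_coe (n : ℕ) (y : ℳ n) : gradedComponent ℳ n y = y :=
  Subtype.ext (DirectSum.decompose_of_mem_same ℳ y.2)

lemma gradedComponent_of_mem_ne {m n : ℕ} {y : E} (hy : y ∈ ℳ m) (h : m ≠ n) :
    gradedComponent ℳ n y = 0 :=
  Subtype.ext (DirectSum.decompose_of_mem_ne ℳ hy h)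

lemma eventually_gradedComponent_eq_zero (y : E) : ∀ᶠ n in atTop, gradedComponent ℳ n y = 0 := by
  induction y using DirectSum.Decomposition.inductionOn ℳ with
  | zero => simp
  | @homogeneous i m =>
    filter_upwards [eventually_gt_atTop i] with n hn
    exact gradedComponent_of_mem_ne ℳ m.2 hn.ne
  | add y z hy hz =>
    filter_upwards [hy, hz] with n hy hz
    rw [map_add, hy, hz, add_zero]

variable [SetLike.GradedSMul 𝒜 ℳ]

omit [DirectSum.Decomposition ℳ] in
lemma smul_mem_component_succ {t : S} (ht : t ∈ 𝒜 1) {n : ℕ} {y : E} (hy : y ∈ ℳ n) :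
    t • y ∈ ℳ (n + 1) := by
  have : t • y ∈ ℳ (1 +ᵥ n) := SetLike.GradedSMul.smul_mem ht hy
  rwa [vadd_eq_add, add_comm] at this

lemma gradedComponent_succ_smul {t : S} (ht : t ∈ 𝒜 1) (n : ℕ) (y : E) :
    (gradedComponent ℳ (n + 1) (t • y) : E) = t • (gradedComponent ℳ n y : E) := by
  induction y using DirectSum.Decomposition.inductionOn ℳ with
  | zero => simp
  | @homogeneous i m =>
    have h := smul_mem_component_succ ℳ ht m.2
    by_cases hin : i = n
    · subst hin
      rw [gradedComponent_coe]
      exact DirectSum.decompose_of_mem_same ℳ h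
    · rw [gradedComponent_of_mem_ne ℳ h (by omega), gradedComponent_of_mem_ne ℳ m.2 hin]
      simp
  | add y z hy hz => simp only [smul_add, map_add, Submodule.coe_add, hy, hz]

lemma gradedComponent_zero_smul {t : S} (ht : t ∈ 𝒜 1) (y : E) :
    gradedComponent ℳ 0 (t • y) = 0 := by
  induction y using DirectSum.Decomposition.inductionOn ℳ with
  | zero => simp
  | @homogeneous i m =>
    exact gradedComponent_of_mem_ne ℳ (smul_mem_component_succ ℳ ht m.2) (by omega)
  | add y z hy hz => rw [smul_add, map_add, hy, hz, add_zero]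

variable [IsScalarTower R S E] (h𝒜 : Algebra.adjoin R (𝒜 1 : Set S) = ⊤)
include h𝒜

/-- Elements without components of degree `< m` form an `S`-submodule. -/
lemma gradedComponent_smul_eq_zero {m : ℕ} (s : S) {y : E}
    (hy : ∀ n < m, gradedComponent ℳ n y = 0) : ∀ n < m, gradedComponent ℳ n (s • y) = 0 := by
  have hs : s ∈ Algebra.adjoin R (𝒜 1 : Set S) := h𝒜 ▸ trivial
  induction hs using Algebra.adjoin_induction generalizing y with
  | mem t ht =>
    rintro (_ | n) hn
    · exact gradedComponent_zero_smul ℳ ht y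
    · apply Subtype.ext
      rw [gradedComponent_succ_smul ℳ ht, hy n (by omega)]
      simp
  | algebraMap r =>
    intro n hn
    rw [algebraMap_smul, map_smul, hy n hn, smul_zero]
  | add a b _ _ ha hb =>
    intro n hn
    rw [add_smul, map_add, ha hy n hn, hb hy n hn, add_zero]
  | mul a b _ _ ha hb =>
    rw [mul_smul]
    exact ha (hb hy)

variable [IsNoetherianRing S] [Module.Finite S E]

/-- Modulo elements without components of degree `< m`, a finitely generated graded module over
a standard graded algebra is finitely generated over the base ring. -/
lemma exists_fg_gradedComponent_sub_eq_zero (m : ℕ) :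
    ∃ F : Submodule R E, F.FG ∧
      ∀ y : E, ∃ f ∈ F, ∀ n < m, gradedComponent ℳ n (y - f) = 0 := by
  obtain ⟨T, hT1, hT⟩ := exists_finset_sub_algebraMap_mem_span h𝒜
  induction m with
  | zero => exact ⟨⊥, Submodule.fg_bot, fun y => ⟨0, zero_mem _, by simp⟩⟩
  | succ m ih =>
    obtain ⟨F, hF, hFy⟩ := ih
    let P (l : ℕ) : Submodule S E :=
      { carrier := {y | ∀ n < l, gradedComponent ℳ n y = 0}
        add_mem' := fun ha hb n hn => by rw [map_add, ha n hn, hb n hn, add_zero]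
        zero_mem' := fun n _ => map_zero _
        smul_mem' := fun s y hy => gradedComponent_smul_eq_zero ℳ h𝒜 s hy }
    have hTP : ∀ s ∈ Ideal.span (T : Set S), ∀ y ∈ P m, s • y ∈ P (m + 1) := by
      intro s hs y hy
      induction hs using Submodule.span_induction with
      | mem t ht =>
        rintro (_ | n) hn
        · exact gradedComponent_zero_smul ℳ (hT1 ht) y
        · apply Subtype.ext
          rw [gradedComponent_succ_smul ℳ (hT1 ht), hy n (by omega)]
          simp
      | zero => rw [zero_smul]; exact zero_mem _
      | add a b _ _ ha hb => rw [add_smul]; exact add_mem ha hb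
      | smul c a _ ha => rw [smul_assoc]; exact Submodule.smul_mem _ _ ha
    obtain ⟨G, hG⟩ : (P m).FG := IsNoetherian.noetherian _
    -- Modulo `(T)`, every coefficient in `S` can be replaced by one in `R`.
    have hstep : ∀ z ∈ Submodule.span S (G : Set E),
        ∃ f ∈ Submodule.span R (G : Set E), z - f ∈ P (m + 1) := by
      intro z hz
      induction hz using Submodule.span_induction with
      | mem g hg => exact ⟨g, Submodule.subset_span hg, by rw [sub_self]; exact zero_mem _⟩
      | zero => exact ⟨0, zero_mem _, by rw [sub_self]; exact zero_mem _⟩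
      | add a b _ _ ha hb =>
        obtain ⟨f, hf, hf'⟩ := ha
        obtain ⟨g, hg, hg'⟩ := hb
        exact ⟨f + g, add_mem hf hg, by rw [add_sub_add_comm]; exact add_mem hf' hg'⟩
      | smul s a ha' ha =>
        obtain ⟨f, hf, hf'⟩ := ha
        obtain ⟨r, hr⟩ := hT s
        refine ⟨r • f, Submodule.smul_mem _ _ hf, ?_⟩
        have : s • a - r • f = (s - algebraMap R S r) • a + algebraMap R S r • (a - f) := by
          rw [sub_smul, smul_sub, algebraMap_smul, algebraMap_smul]
          abel
        rw [this]
        exact add_mem (hTP _ hr a (hG.le ha')) (Submodule.smul_mem _ _ hf')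
    refine ⟨F ⊔ Submodule.span R (G : Set E), hF.sup ⟨G, rfl⟩, fun y => ?_⟩
    obtain ⟨f, hf, hyf⟩ := hFy y
    obtain ⟨g, hg, hyg⟩ := hstep (y - f) (hG.ge hyf)
    exact ⟨f + g, Submodule.add_mem_sup hf hg, by rw [← sub_sub]; exact hyg⟩

lemma finite_component (n : ℕ) : Module.Finite R (ℳ n) := by
  obtain ⟨F, hF, hFy⟩ := exists_fg_gradedComponent_sub_eq_zero ℳ h𝒜 (n + 1)
  refine ⟨(eq_top_iff.mpr fun y _ => ?_ : F.map (gradedComponent ℳ n) = ⊤) ▸ hF.map _⟩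
  obtain ⟨f, hf, hyf⟩ := hFy y
  refine ⟨f, hf, ?_⟩
  rw [← sub_eq_zero, ← gradedComponent_coe ℳ n y, ← map_sub, ← neg_sub, map_neg, hyf n (by omega), neg_zero]

/-- The quotient `ℳ n / 𝔞 (ℳ n)` is the component of degree `n` of `E / 𝔞E`, because `𝔞E` is a graded
submodule. -/
theorem hasStableAssociatedPrimes_component [IsNoetherianRing R] :
    HasStableAssociatedPrimes R fun n => ℳ n := by
  intro a
  obtain ⟨T, hT1, hT⟩ := exists_finset_sub_algebraMap_mem_span h𝒜
  let Q : Submodule S E := a.map (algebraMap R S) • ⊤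
  have hQ : Q.restrictScalars R = a • (⊤ : Submodule R E) :=
    (Ideal.smul_restrictScalars a ⊤)
  have hQmem (y : E) : y ∈ Q ↔ y ∈ a • (⊤ : Submodule R E) := by rw [← hQ]; rfl
  have hcomp (n : ℕ) (y : E) (hy : y ∈ Q) :
      gradedComponent ℳ n y ∈ a • (⊤ : Submodule R (ℳ n)) := by
    have := Submodule.mem_map_of_mem (f := gradedComponent ℳ n) ((hQmem y).mp hy)
    rw [Submodule.map_smul''] at this
    exact Submodule.smul_mono le_rfl le_top this
  have hmk (n : ℕ) (y : ℳ n) : (y : E) ∈ Q ↔ y ∈ a • (⊤ : Submodule R (ℳ n)) := by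
    constructor
    · intro hy
      simpa only [gradedComponent_coe] using hcomp n y hy
    · intro hy
      have := Submodule.mem_map_of_mem (f := (ℳ n).subtype) hy
      rw [Submodule.map_smul''] at this
      exact (hQmem _).mpr (Submodule.smul_mono le_rfl le_top this)
  obtain ⟨X, hX⟩ := exists_eventually_associatedPrimes_quotient_comap_eq ⊤ Q T hT
    (fun n => (ℳ n).subtype) (fun _ _ => trivial)
    (fun n t ht y => ⟨⟨t • (y : E), smul_mem_component_succ ℳ (hT1 ht) y.2⟩, by simp⟩)
    (fun n => (a • (⊤ : Submodule R (ℳ n))).mkQ ∘ₗ gradedComponent ℳ n)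
    (fun n y hy => (Submodule.Quotient.mk_eq_zero _).mpr (hcomp n y hy))
    (fun n y hy => (hmk n y).mpr ((Submodule.Quotient.mk_eq_zero _).mp
      (gradedComponent_coe ℳ n y ▸ hy)))
    (fun y => by
      filter_upwards [eventually_gradedComponent_eq_zero ℳ y] with n hn
      rw [LinearMap.comp_apply, hn, map_zero])
  refine ⟨X, hX.mono fun n hn => ?_⟩
  rw [← hn, show (Q.restrictScalars R).comap (ℳ n).subtype = a • ⊤ from
    Submodule.ext fun y => hmk n y]

end Graded

/-! ### Quotients by powers of an ideal -/

section Powers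

variable {R : Type u} [CommRing R] (J : Ideal R) (M : Type u) [AddCommGroup M] [Module R M]

lemma adjoin_preimage_monomial_eq_top :
    Algebra.adjoin R {f : reesAlgebra J | ∃ r ∈ J, (f : Polynomial R) = Polynomial.monomial 1 r} =
      ⊤ := by
  apply Subalgebra.map_injective (f := (reesAlgebra J).val) Subtype.val_injective
  rw [AlgHom.map_adjoin, Algebra.map_top, Subalgebra.range_val]
  conv_rhs => rw [← adjoin_monomial_eq_reesAlgebra]
  congr 1
  ext f
  constructor
  · rintro ⟨f, ⟨r, hr, hf⟩, rfl⟩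
    exact ⟨r, hr, hf.symm⟩
  · rintro ⟨r, hr, rfl⟩
    exact ⟨⟨_, reesAlgebra.monomial_mem.mpr (by simpa using hr)⟩, ⟨r, hr, rfl⟩, rfl⟩

variable [IsNoetherianRing R] [Module.Finite R M]

/-- The components `JⁿM / Jⁿ⁺¹M` of the associated graded module have stable associated primes.
The associated graded module is encoded as the quotient of two submodules of `M[X]` over the Rees
algebra of `J`, consisting of the polynomials with `n`-th coefficient in `JⁿM`, respectively in
`Jⁿ⁺¹M`. -/
lemma exists_eventually_associatedPrimes_gr_eq :
    ∃ A : Set (Ideal R), ∀ᶠ n in atTop, associatedPrimes R (LinearMap.range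
      ((J ^ (n + 1) • (⊤ : Submodule R M)).mkQ ∘ₗ (J ^ n • (⊤ : Submodule R M)).subtype)) = A := by
  have : IsNoetherianRing (reesAlgebra J) := by
    have : Algebra.FiniteType R (reesAlgebra J) :=
      (reesAlgebra J).fg_iff_finiteType.mp (reesAlgebra.fg (IsNoetherian.noetherian J))
    exact Algebra.FiniteType.isNoetherianRing R _
  let F : J.Filtration M := J.stableFiltration ⊤
  let F' : J.Filtration M := J.stableFiltration (J • ⊤)
  have hF' (n : ℕ) : F'.N n = J ^ (n + 1) • ⊤ := by
    change J ^ n • J • ⊤ = _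
    rw [smul_smul, ← pow_succ]
  have hfin : Module.Finite (reesAlgebra J) F.submodule := Module.Finite.iff_fg.mpr
    ((F.submodule_fg_iff_stable fun i => IsNoetherian.noetherian _).mpr
      (J.stableFiltration_stable ⊤))
  have hB (f : PolynomialModule R M) :
      f ∈ F'.submodule ↔ ∀ n, f.coeff n ∈ J ^ (n + 1) • (⊤ : Submodule R M) := by
    simp only [← hF', Ideal.Filtration.mem_submodule]
  have hsingle (N : ℕ → Submodule R M) (n : ℕ) (y : M) :
      (∀ i, (PolynomialModule.single R n y).coeff i ∈ N i) ↔ y ∈ N n := by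
    refine ⟨fun h => by simpa using h n, fun h i => ?_⟩
    rw [PolynomialModule.coeff_single, Finsupp.single_apply]
    split_ifs with hi
    · exact hi ▸ h
    · exact zero_mem _
  obtain ⟨T, hTJ, hT⟩ := exists_finset_sub_algebraMap_mem_span (adjoin_preimage_monomial_eq_top J)
  let φ (n : ℕ) : (J ^ n • (⊤ : Submodule R M) : Submodule R M) →ₗ[R] PolynomialModule R M :=
    PolynomialModule.lsingle R n ∘ₗ Submodule.subtype _
  have hφ (n : ℕ) (y : (J ^ n • (⊤ : Submodule R M) : Submodule R M)) :
      φ n y = PolynomialModule.single R n (y : M) := rfl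
  have hφB (n : ℕ) (y : (J ^ n • (⊤ : Submodule R M) : Submodule R M)) :
      φ n y ∈ F'.submodule ↔ (y : M) ∈ J ^ (n + 1) • (⊤ : Submodule R M) := by
    rw [hB, hφ, hsingle (fun n => J ^ (n + 1) • (⊤ : Submodule R M))]
  let ψ (n : ℕ) : PolynomialModule R M →ₗ[R] M ⧸ (J ^ (n + 1) • (⊤ : Submodule R M)) :=
    Submodule.mkQ _ ∘ₗ Finsupp.lapply n ∘ₗ (PolynomialModule.coeffLinearEquiv R R).toLinearMap
  have hψ (n : ℕ) (f : PolynomialModule R M) :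
      ψ n f = 0 ↔ f.coeff n ∈ J ^ (n + 1) • (⊤ : Submodule R M) :=
    Submodule.Quotient.mk_eq_zero _
  obtain ⟨X, hX⟩ := exists_eventually_associatedPrimes_quotient_comap_eq F.submodule F'.submodule
    T hT φ (fun n y => (hsingle F.N n y).mpr y.2)
    (fun n t ht y => by
      obtain ⟨r, hr, htr⟩ := hTJ ht
      refine ⟨⟨r • (y : M), ?_⟩, ?_⟩
      · rw [pow_succ', mul_smul]
        exact Submodule.smul_mem_smul hr y.2
      · rw [Subalgebra.smul_def, htr, hφ, hφ, PolynomialModule.monomial_smul_single,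
          add_comm 1 n, sub_self]
        exact zero_mem _)
    ψ (fun n b hb => (hψ n b).mpr ((hB b).mp hb n))
    (fun n y hy => by
      rw [hψ, hφ] at hy
      exact (hφB n y).mpr (by simpa using hy))
    (fun f => by
      filter_upwards [eventually_gt_atTop (f.coeff.support.sup id)] with n hn
      rw [hψ, Finsupp.notMem_support_iff.mp fun h => absurd (Finset.le_sup (f := id) h)
        (not_le.mpr hn)]
      exact zero_mem _)
  refine ⟨X, hX.mono fun n hn => ?_⟩
  rw [← hn]
  refine (LinearEquiv.AssociatedPrimes.eq ((Submodule.quotEquivOfEq _ _ ?_).trans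
    (LinearMap.quotKerEquivRange _))).symm
  ext y
  exact (hφB n y).trans (Submodule.Quotient.mk_eq_zero _).symm

/-- Brodmann's theorem. The exact sequences
`0 → JⁿM / Jⁿ⁺¹M → M / Jⁿ⁺¹M → M / JⁿM → 0` show that `Ass (M / JⁿM)` is eventually decreasing. -/
theorem exists_eventually_associatedPrimes_quotient_pow_eq :
    ∃ A : Set (Ideal R), ∀ᶠ n in atTop,
      associatedPrimes R (M ⧸ (J ^ n • (⊤ : Submodule R M))) = A := by
  obtain ⟨A, hA⟩ := exists_eventually_associatedPrimes_gr_eq J M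
  obtain ⟨n₀, hn₀⟩ := eventually_atTop.mp hA
  let X (n : ℕ) : Set (Ideal R) := associatedPrimes R (M ⧸ (J ^ n • (⊤ : Submodule R M)))
  have hAX (n : ℕ) (hn : n₀ ≤ n) : A ⊆ X (n + 1) := by
    rw [← hn₀ n hn]
    exact associatedPrimes.subset_of_injective (f := Submodule.subtype _) Subtype.val_injective
  have hXA (n : ℕ) (hn : n₀ ≤ n) : X (n + 1) ⊆ A ∪ X n := by
    rw [← hn₀ n hn]
    have hle : J ^ (n + 1) • (⊤ : Submodule R M) ≤ J ^ n • ⊤ :=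
      Submodule.smul_mono_left (Ideal.pow_le_pow_right n.le_succ)
    refine associatedPrimes.subset_union_of_exact (f := Submodule.subtype _)
      (g := Submodule.factor hle) Subtype.val_injective fun y => ?_
    obtain ⟨y, rfl⟩ := Submodule.Quotient.mk_surjective _ y
    change Submodule.Quotient.mk y = 0 ↔ _
    rw [Submodule.Quotient.mk_eq_zero]
    constructor
    · intro hy
      exact ⟨⟨_, ⟨y, hy⟩, rfl⟩, rfl⟩
    · rintro ⟨⟨_, ⟨z, rfl⟩⟩, hz⟩
      have h : y - (z : M) ∈ J ^ (n + 1) • (⊤ : Submodule R M) :=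
        (Submodule.Quotient.eq _).mp hz.symm
      exact sub_add_cancel y (z : M) ▸ add_mem (hle h) z.2
  have hdecr (n : ℕ) (hn : n₀ + 1 ≤ n) : X (n + 1) ⊆ X n := by
    obtain ⟨m, rfl⟩ := Nat.exists_eq_add_of_le' (show 1 ≤ n by omega)
    exact (hXA _ (by omega)).trans (Set.union_subset (hAX m (by omega)) subset_rfl)
  have hle (n : ℕ) (hn : n₀ + 1 ≤ n) : X n ⊆ X (n₀ + 1) := by
    induction n, hn using Nat.le_induction with
    | base => rfl
    | succ n hn ih => exact (hdecr n hn).trans ih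
  -- The complements in the finite set `X (n₀ + 1)` are increasing.
  obtain ⟨C, hC⟩ := exists_eventually_eq_of_subset (X := fun n => X (n₀ + 1) \ X n)
    (associatedPrimes.finite R (M ⧸ (J ^ (n₀ + 1) • (⊤ : Submodule R M))))
    (Eventually.of_forall fun n => Set.sdiff_subset)
    ((eventually_ge_atTop (n₀ + 1)).mono fun n hn => Set.sdiff_subset_sdiff_right (hdecr n hn))
  refine ⟨X (n₀ + 1) \ C, ?_⟩
  filter_upwards [hC, eventually_ge_atTop (n₀ + 1)] with n hn hn'
  rw [← hn, Set.sdiff_sdiff_cancel_left (hle n hn')]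

theorem hasStableAssociatedPrimes_quotient_pow :
    HasStableAssociatedPrimes R fun n => M ⧸ (J ^ n • (⊤ : Submodule R M)) := by
  intro a
  obtain ⟨A, hA⟩ := exists_eventually_associatedPrimes_quotient_pow_eq J
    (M ⧸ (a • (⊤ : Submodule R M)))
  refine ⟨A, hA.mono fun n hn => ?_⟩
  have h (b c : Ideal R) : Nonempty (((M ⧸ (b • (⊤ : Submodule R M))) ⧸
      (c • (⊤ : Submodule R (M ⧸ (b • (⊤ : Submodule R M)))))) ≃ₗ[R]
      M ⧸ (b • (⊤ : Submodule R M) ⊔ c • ⊤)) :=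
    ⟨(Submodule.quotEquivOfEq _ _ (by
      rw [Submodule.map_smul'', Submodule.map_top, Submodule.range_mkQ])).trans
      (Submodule.quotientQuotientEquivQuotientSup (b • ⊤) (c • ⊤))⟩
  obtain ⟨e⟩ := h (J ^ n) a
  obtain ⟨e'⟩ := h a (J ^ n)
  rw [← hn]
  exact LinearEquiv.AssociatedPrimes.eq
    (e.trans ((Submodule.quotEquivOfEq _ _ (sup_comm _ _)).trans e'.symm))

end Powers

/-! ### Asymptotic depth -/

theorem mainTheorem2 {R : Type u} [CommRing R] [IsLocalRing R] [IsNoetherianRing R]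
    (I : Ideal R) (k : ℤ) (hk : -1 ≤ k) :
    (∀ (S : Type u) [CommRing S] [Algebra R S] (𝒜 : ℕ → Submodule R S) [GradedAlgebra 𝒜]
        (_ : IsStandardGraded 𝒜)
        (E : Type u) [AddCommGroup E] [Module R E] [Module S E] [IsScalarTower R S E]
        (ℳ : ℕ → Submodule R E) [DirectSum.Decomposition ℳ] [SetLike.GradedSMul 𝒜 ℳ]
        [Module.Finite S E],
      ∃ r : ℕ∞, (∀ᶠ n in atTop, IsDepthInDimGT k I (ℳ n) r) ∧
        r = sInf ((fun i : ℕ => (i : ℕ∞)) ''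
          {i : ℕ | {n : ℕ | DimGT k (extDim I (ℳ n) i)}.Infinite})) ∧
    (∀ (J : Ideal R) (M : Type u) [AddCommGroup M] [Module R M] [Module.Finite R M],
      ∃ r : ℕ∞,
        (∀ᶠ n : ℕ in atTop, IsDepthInDimGT k I (M ⧸ (J ^ n • (⊤ : Submodule R M))) r) ∧
        r = sInf ((fun i : ℕ => (i : ℕ∞)) ''
          {i : ℕ | {n : ℕ | DimGT k
            (extDim I (M ⧸ (J ^ n • (⊤ : Submodule R M))) i)}.Infinite})) := by
  refine ⟨?_, fun J M _ _ _ =>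
    (hasStableAssociatedPrimes_quotient_pow J M).exists_eventually_isDepthInDimGT I k⟩
  intro S _ _ 𝒜 _ h𝒜 E _ _ _ _ ℳ _ _ _
  have := h𝒜.finiteType
  have : IsNoetherianRing S := Algebra.FiniteType.isNoetherianRing R S
  have := finite_component ℳ h𝒜.generated
  exact (hasStableAssociatedPrimes_component ℳ h𝒜.generated).exists_eventually_isDepthInDimGT I k
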